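/- For a graph $G=(V,E)$, let $N(v)$ denote the set of neighbours of a vertex $v$, and let the colouring number $\operatorname{col}(G)$ be the smallest cardinal $\kappa$ for which there is a well-ordering $<^*$ of $V$ such that $|N(v)\cap\{w : w<^* v\}|<\kappa$ for all $v\in V$. Theorem. Let $\mu$ be an infinite cardinal and let $G$ be a graph with $\operatorname{col}(G)>\mu$. Then either $G$ contains a $K_\mu$, i.e. a set of $\mu$ mutually adjacent vertices, or, for every positive integer $k$, $G$ contains the complete bipartite graph $K_{k,\omega}$ (with one side of size $k$ and the other side countably infinite) as an induced subgraph. ("Or" is inclusive.) -/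

import Mathlib

open Cardinal

/-- `κ` bounds the back-degrees of `G` in some well-ordering `r` of its vertices: every vertex `v`
has fewer than `κ` neighbours `w` with `r w v`. -/
def SimpleGraph.HasColouringOrder {V : Type*} (G : SimpleGraph V) (κ : Cardinal) : Prop :=
  ∃ r : V → V → Prop, IsWellOrder V r ∧ ∀ v : V, #↥(G.neighborSet v ∩ {w | r w v}) < κ

/-- The colouring number of `G`: the smallest cardinal `κ` such that some well-ordering of the
vertices has all back-degrees smaller than `κ`. -/
noncomputable def SimpleGraph.colouringNumber {V : Type*} (G : SimpleGraph V) : Cardinal :=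
  sInf {κ | G.HasColouringOrder κ}

/-- The infimum in the definition of the colouring number is attained. -/
theorem SimpleGraph.hasColouringOrder_colouringNumber {V : Type*} (G : SimpleGraph V) :
    G.HasColouringOrder G.colouringNumber := by
  have hne : {κ | G.HasColouringOrder κ}.Nonempty :=
    ⟨Order.succ #V, WellOrderingRel, inferInstance, fun v =>
      lt_of_le_of_lt (mk_set_le _) (Order.lt_succ _)⟩
  exact csInf_mem hne

universe u

/-! Assume neither alternative holds. By Erdős–Dushnik–Miller, every set of at least `μ` vertices
contains an infinite independent set. So an independent `k`-set `K` has at most `μ` common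
neighbours, and any `μ` neighbours of a vertex `v` include such a `K`, with `v` among its common
neighbours. Hence a vertex outside a set closed under taking these common neighbours sends fewer
than `μ` edges into it. Exhausting the graph by an increasing chain of smaller closed sets and
ordering the layers by induction on cardinality gives a well-ordering with back-degrees below `μ`.
-/

theorem Cardinal.mk_iUnion_lt_of_lt_cof_ord {α ι : Type u} {c : Cardinal.{u}} (hc : ℵ₀ ≤ c)
    (A : ι → Set α) (hι : #ι < c.ord.cof) (hA : ∀ i, #(A i) < c) : #(⋃ i, A i) < c :=
  (mk_iUnion_le A).trans_lt
    (mul_lt_of_lt hc (hι.trans_le (Ordinal.cof_ord_le c)) (iSup_lt_of_lt_cof_ord hι hA))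

/-- Choice along a well-founded relation: the value at `i` may depend on all earlier values. -/
theorem WellFounded.exists_forall_rel {ι : Type*} {β : Type*} {r : ι → ι → Prop}
    (hr : WellFounded r) (Q : ∀ i, (∀ j, r j i → β) → β → Prop) (h : ∀ i f, ∃ b, Q i f b) :
    ∃ F : ι → β, ∀ i, Q i (fun j _ => F j) (F i) := by
  choose c hc using h
  refine ⟨hr.fix c, fun i => ?_⟩
  conv => arg 3; rw [hr.fix_eq]
  exact hc _ _

/-! ### The Erdős–Dushnik–Miller theorem -/

namespace SimpleGraph

variable {V : Type u} (G : SimpleGraph V)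

/-- Otherwise one can forever pick a vertex with a full-size set of non-neighbours and pass to that
set; the picks are infinite and independent. -/
theorem exists_forall_mk_compl_neighborSet_inter_lt {X : Set V}
    (hI : ∀ I ⊆ X, G.IsIndepSet I → I.Finite) :
    ∃ U ⊆ X, #U = #X ∧ ∀ v ∈ U, #↥(Gᶜ.neighborSet v ∩ U) < #X := by
  by_contra! h
  have step : ∀ U : {U : Set V // U ⊆ X ∧ #U = #X}, ∃ v ∈ U.1,
      #↥(Gᶜ.neighborSet v ∩ U.1) = #X := by
    intro U
    obtain ⟨v, hv, hle⟩ := h U.1 U.2.1 U.2.2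
    exact ⟨v, hv, ((mk_le_mk_of_subset Set.inter_subset_right).trans_eq U.2.2).antisymm hle⟩
  choose p hp hcard using step
  let next : {U : Set V // U ⊆ X ∧ #U = #X} → {U : Set V // U ⊆ X ∧ #U = #X} := fun U =>
    ⟨Gᶜ.neighborSet (p U) ∩ U.1, Set.inter_subset_right.trans U.2.1, hcard U⟩
  let s : ℕ → {U : Set V // U ⊆ X ∧ #U = #X} := fun n => next^[n] ⟨X, subset_rfl, rfl⟩
  have hs : ∀ n, (s (n + 1)).1 = Gᶜ.neighborSet (p (s n)) ∩ (s n).1 := fun n => by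
    simp only [s, Function.iterate_succ_apply', next]
  have hanti : Antitone fun n => (s n).1 :=
    antitone_nat_of_succ_le fun n => (hs n).trans_subset Set.inter_subset_right
  have hadj : ∀ m n, m < n → Gᶜ.Adj (p (s m)) (p (s n)) := fun m n hmn => by
    have := hanti (Nat.succ_le_of_lt hmn) (hp (s n))
    simp only [Nat.succ_eq_add_one, hs] at this
    exact this.1
  have hinj : Function.Injective fun n => p (s n) := fun m n hmn => by
    by_contra hne
    rcases Nat.lt_or_gt_of_ne hne with hlt | hlt
    · exact (hadj _ _ hlt).ne hmn
    · exact (hadj _ _ hlt).ne hmn.symm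
  refine Set.infinite_range_of_injective hinj (hI _ ?_ ?_)
  · rintro _ ⟨n, rfl⟩
    exact (s n).2.1 (hp _)
  · rw [← isClique_compl]
    rintro _ ⟨m, rfl⟩ _ ⟨n, rfl⟩ hne
    rcases Nat.lt_or_gt_of_ne (fun h : m = n => hne (h ▸ rfl)) with hlt | hlt
    · exact hadj _ _ hlt
    · exact (hadj _ _ hlt).symm

theorem exists_maximal_isClique_subset (U : Set V) :
    ∃ S, Maximal (fun S => S ⊆ U ∧ G.IsClique S) S := by
  refine zorn_subset {S | S ⊆ U ∧ G.IsClique S} fun c hc hchain =>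
    ⟨⋃₀ c, ⟨Set.sUnion_subset fun s hs => (hc hs).1, ?_⟩, fun s hs => Set.subset_sUnion_of_mem hs⟩
  rintro v ⟨s, hs, hv⟩ w ⟨t, ht, hw⟩ hne
  rcases hchain.total hs ht with hst | hst
  · exact (hc ht).2 (hst hv) hw hne
  · exact (hc hs).2 hv (hst hw) hne

/-- By regularity, a clique in `U` of size below `#X` and the non-neighbours of its members cannot
cover `U`, so the clique is not maximal. -/
theorem exists_isClique_mk_eq_of_isRegular {X : Set V} (hX : (#X).IsRegular)
    (hI : ∀ I ⊆ X, G.IsIndepSet I → I.Finite) : ∃ S ⊆ X, #S = #X ∧ G.IsClique S := by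
  obtain ⟨U, hUX, hU, hdeg⟩ := G.exists_forall_mk_compl_neighborSet_inter_lt hI
  obtain ⟨S, hS⟩ := G.exists_maximal_isClique_subset U
  refine ⟨S, hS.prop.1.trans hUX, ?_, hS.prop.2⟩
  refine ((mk_le_mk_of_subset hS.prop.1).trans_eq hU).antisymm (not_lt.1 fun hlt => ?_)
  have hlt' : #↥(S ∪ ⋃ v : S, Gᶜ.neighborSet v ∩ U) < #X :=
    (mk_union_le _ _).trans_lt (add_lt_of_lt hX.aleph0_le hlt
      (mk_iUnion_lt_of_lt_cof_ord hX.aleph0_le _ (by rwa [hX.cof_ord])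
        fun v => hdeg v (hS.prop.1 v.2)))
  obtain ⟨w, hwU, hw⟩ : ∃ w ∈ U, w ∉ S ∪ ⋃ v : S, Gᶜ.neighborSet v ∩ U := by
    by_contra! h
    exact (hU.symm.trans_le (mk_le_mk_of_subset h)).not_gt hlt'
  simp only [Set.mem_union, Set.mem_iUnion, not_or, not_exists, Set.mem_inter_iff,
    mem_neighborSet, compl_adj] at hw
  refine hw.1 (hS.le_of_ge (y := insert w S)
    ⟨Set.insert_subset hwU hS.prop.1, hS.prop.2.insert fun v hv hne => ?_⟩
    (Set.subset_insert _ _) (Set.mem_insert _ _))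
  by_contra hadj
  exact hw.2 ⟨v, hv⟩ ⟨⟨hne.symm, fun h => hadj h.symm⟩, hwU⟩

end SimpleGraph

theorem Cardinal.exists_cofinal_family (c : Cardinal.{u}) :
    ∃ (ι : Type u) (g : ι → Cardinal.{u}), #ι = c.ord.cof ∧ (∀ i, g i < c) ∧
      ∀ d < c, ∃ i, d ≤ g i := by
  obtain ⟨s, hs, hcard⟩ := Order.exists_cof_eq c.ord.ToType
  refine ⟨s, fun i => (Ordinal.typein (α := c.ord.ToType) (· < ·) i.1).card, by rw [hcard, Ordinal.cof_toType],
    fun i => ?_, fun d hd => ?_⟩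
  · rw [← lt_ord]
    exact Ordinal.typein_lt_self i.1
  · obtain ⟨x, hx⟩ := Ordinal.typein_surj (α := c.ord.ToType) (· < ·) (o := d.ord)
      (by rw [Ordinal.type_toType]; exact ord_lt_ord.2 hd)
    obtain ⟨y, hy, hxy⟩ := hs x
    refine ⟨⟨y, hy⟩, ?_⟩
    rw [← ord_le, ← hx]
    exact (Ordinal.typein_le_typein' _).2 hxy

namespace SimpleGraph

variable {V : Type u} (G : SimpleGraph V)

/-- The clique is a union of cofinality-many cliques of cofinal sizes, chosen recursively and
completely joined to one another. -/
theorem exists_isClique_mk_eq_of_isSingular {X : Set V} (hX : (#X).IsSingular)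
    (hI : ∀ I ⊆ X, G.IsIndepSet I → I.Finite) : ∃ S ⊆ X, #S = #X ∧ G.IsClique S := by
  obtain ⟨U, hUX, hU, hdeg⟩ := G.exists_forall_mk_compl_neighborSet_inter_lt hI
  obtain ⟨ι, g, hι, hg, hgcof⟩ := exists_cofinal_family #X
  obtain ⟨r, hr, hord⟩ := exists_ord_eq ι
  let small : Set V → Prop := fun W => W ⊆ U ∧ #W < #X ∧
    ∃ d < #X, ∀ v ∈ W, #↥(Gᶜ.neighborSet v ∩ U) ≤ d
  have key : ∀ (i : ι) (f : ∀ j, r j i → Set V), ∃ W : Set V, (∀ j h, small (f j h)) →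
      small W ∧ G.IsClique W ∧ g i ≤ #W ∧ ∀ j h, ∀ v ∈ f j h, ∀ w ∈ W, G.Adj v w := by
    intro i f
    by_cases hf : ∀ j h, small (f j h)
    swap
    -- Junk value: smallness of the earlier blocks is only established by induction after the
    -- recursion.
    · exact ⟨∅, fun h => (hf h).elim⟩
    let A : {j // r j i} → Set V := fun j =>
      f j j.2 ∪ ⋃ v : f j j.2, Gᶜ.neighborSet v ∩ U
    have hA : ∀ j, #(A j) < #X := fun j => by
      obtain ⟨hsub, hlt, d, hd, hdle⟩ := hf j j.2
      refine (mk_union_le _ _).trans_lt (add_lt_of_lt hX.aleph0_le hlt ?_)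
      refine (mk_iUnion_le _).trans_lt (mul_lt_of_lt hX.aleph0_le hlt ?_)
      exact (ciSup_le' fun v : f j j.2 => hdle v v.2).trans_lt hd
    have hAU : #(⋃ j, A j) < #X :=
      mk_iUnion_lt_of_lt_cof_ord hX.aleph0_le A (hι ▸ card_typein_lt i hord) hA
    have hR : #X ≤ #↥(U \ ⋃ j, A j) := by
      by_contra! hlt
      refine (add_lt_of_lt hX.aleph0_le hlt hAU).not_ge (hU.symm.trans_le ?_)
      exact (mk_le_mk_of_subset (by rw [Set.sdiff_union_self]; exact Set.subset_union_left)).trans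
        (mk_union_le _ _)
    -- Regular for the previous case, above `#ι` for the pigeonhole, and still below the limit
    -- cardinal `#X`.
    set ν := Order.succ (max ℵ₀ (max (g i) #ι)) with hν
    have hνreg : ν.IsRegular := isRegular_succ (le_max_left _ _)
    have hcofι : #ι < #X := hι.trans_lt hX.cof_ord_lt
    have hνlt : ν < #X := hX.isSuccLimit.succ_lt (max_lt (hX.aleph0_le.lt_of_ne ?_)
      (max_lt (hg i) hcofι))
    swap
    · rintro h
      exact not_isSingular_aleph0 (h ▸ hX)
    obtain ⟨Y, hYR, hY⟩ := le_mk_iff_exists_subset.1 (hνlt.le.trans hR)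
    obtain ⟨S, hSY, hS, hclique⟩ := G.exists_isClique_mk_eq_of_isRegular (X := Y) (hY ▸ hνreg)
      fun I hI' => hI I (hI'.trans (hYR.trans (Set.sdiff_subset.trans hUX)))
    have hSU : S ⊆ U := hSY.trans (hYR.trans Set.sdiff_subset)
    choose h hh using fun v : S => hgcof _ (hdeg v (hSU v.2))
    -- Uniform bound on non-neighbours within `W`, so that later blocks can avoid them all.
    obtain ⟨a, W, hWS, hW, hWa⟩ := infinite_pigeonhole_set h ν (hS.trans hY).ge hνreg.aleph0_le
      (by rw [hνreg.cof_ord]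
          exact Order.lt_succ_of_le ((le_max_right _ _).trans (le_max_right _ _)))
    refine ⟨W, fun _ => ⟨⟨hWS.trans hSU, ?_, g a, hg a, fun v hv => ?_⟩, hclique.subset hWS, ?_,
      fun j hj v hv w hw => ?_⟩⟩
    · exact (mk_le_mk_of_subset hWS).trans_lt ((hS.trans hY).trans_lt hνlt)
    · exact hWa hv ▸ hh ⟨v, hWS hv⟩
    · exact ((le_max_left _ _).trans (le_max_right _ _)).trans ((Order.le_succ _).trans hW)
    · by_contra hadj
      refine (hYR (hSY (hWS hw))).2 (Set.mem_iUnion.2 ⟨⟨j, hj⟩, ?_⟩)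
      by_cases hvw : v = w
      · exact Or.inl (hvw ▸ hv)
      · exact Or.inr (Set.mem_iUnion.2 ⟨⟨v, hv⟩, ⟨hvw, hadj⟩, hSU (hWS hw)⟩)
  obtain ⟨F, hF⟩ := hr.wf.exists_forall_rel _ key
  have hsmall : ∀ i, small (F i) := fun i =>
    hr.wf.induction i fun i ih => (hF i ih).1
  have hF' := fun i => (hF i fun j _ => hsmall j).2
  have hsub : (⋃ i, F i) ⊆ X := Set.iUnion_subset fun i => (hsmall i).1.trans hUX
  refine ⟨⋃ i, F i, hsub, (mk_le_mk_of_subset hsub).antisymm (not_lt.1 fun hlt => ?_), ?_⟩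
  · obtain ⟨i, hi⟩ := hgcof _ (hX.isSuccLimit.succ_lt hlt)
    exact (Order.lt_succ _).not_ge
      (hi.trans ((hF' i).2.1.trans (mk_le_mk_of_subset (Set.subset_iUnion F i))))
  · intro v hv w hw hne
    obtain ⟨i, hi⟩ := Set.mem_iUnion.1 hv
    obtain ⟨j, hj⟩ := Set.mem_iUnion.1 hw
    rcases trichotomous_of r i j with hij | rfl | hij
    · exact (hF' j).2.2 i hij v hi w hj
    · exact (hF' i).1 hi hj hne
    · exact ((hF' i).2.2 j hij w hj v hi).symm

/-- The **Erdős–Dushnik–Miller theorem** for sets of vertices: an infinite set without infinite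
independent subsets contains a clique of full cardinality. -/
theorem exists_isClique_mk_eq {X : Set V} (hX : ℵ₀ ≤ #X)
    (hI : ∀ I ⊆ X, G.IsIndepSet I → I.Finite) : ∃ S ⊆ X, #S = #X ∧ G.IsClique S :=
  (isRegular_or_isSingular hX).elim (G.exists_isClique_mk_eq_of_isRegular · hI)
    (G.exists_isClique_mk_eq_of_isSingular · hI)

end SimpleGraph

/-! ### Closures and well-orderings with small back-degrees -/

/-- A finitary set operator whose values have size at most `μ` has a closure operator that does not
increase cardinalities `≥ μ`. -/
theorem Cardinal.exists_closure_mk_le {V : Type u} {μ : Cardinal.{u}} (hμ : ℵ₀ ≤ μ)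
    (N : Finset V → Set V) (hN : ∀ K, #(N K) ≤ μ) :
    ∃ cl : Set V → Set V, Monotone cl ∧ (∀ Z, Z ⊆ cl Z) ∧
      (∀ (Z : Set V) (K : Finset V), ↑K ⊆ cl Z → N K ⊆ cl Z) ∧ ∀ Z, #(cl Z) ≤ max #Z μ := by
  let step : Set V → Set V := fun Z =>
    Z ∪ ⋃ K : Finset Z, N (K.map (Function.Embedding.subtype _))
  have hstep : ∀ (Z : Set V) (K : Finset V), ↑K ⊆ Z → N K ⊆ step Z := by
    classical
    intro Z K hK x hx
    refine Or.inr (Set.mem_iUnion.2 ⟨K.subtype (· ∈ Z), ?_⟩)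
    rwa [Finset.subtype_map_of_mem fun x hx => hK hx]
  have hext : ∀ Z, Z ⊆ step Z := fun Z => Set.subset_union_left
  have hmono : Monotone step := fun Z Z' h => by
    refine Set.union_subset (h.trans (hext _)) (Set.iUnion_subset fun K => hstep _ _ ?_)
    intro x hx
    obtain ⟨y, -, rfl⟩ := Finset.mem_map.1 hx
    exact h y.2
  have hcard : ∀ Z, #(step Z) ≤ max #Z μ := fun Z => by
    have hfin : #(Finset Z) ≤ max #Z μ := by
      cases finite_or_infinite Z
      · have := Fintype.ofFinite Z
        exact (mk_lt_aleph0 (α := Finset Z)).le.trans (hμ.trans (le_max_right _ _))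
      · exact (mk_finset_of_infinite Z).trans_le (le_max_left _ _)
    have hinf : ℵ₀ ≤ max #Z μ := hμ.trans (le_max_right _ _)
    refine (mk_union_le _ _).trans (add_le_of_le hinf (le_max_left _ _) ?_)
    refine (mk_iUnion_le _).trans (mul_le_of_le hinf hfin ?_)
    exact (ciSup_le' fun K => hN _).trans (le_max_right _ _)
  have hiter : ∀ Z, Monotone fun n => step^[n] Z := fun Z =>
    monotone_nat_of_le_succ fun n => by
      rw [Function.iterate_succ_apply']
      exact hext _
  refine ⟨fun Z => ⋃ n : ULift.{u} ℕ, step^[n.down] Z,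
    fun Z Z' h => Set.iUnion_mono fun n => hmono.iterate n.down h,
    fun Z => Set.subset_iUnion (fun n : ULift.{u} ℕ => step^[n.down] Z) ⟨0⟩,
    fun Z K hK => ?_, fun Z => ?_⟩
  · choose! f hf using fun x (hx : x ∈ K) => Set.mem_iUnion.1 (hK hx)
    obtain ⟨n, hn⟩ := (K.image fun x => (f x).down).exists_le
    refine Set.Subset.trans ?_
      (Set.subset_iUnion (fun n : ULift.{u} ℕ => step^[n.down] Z) ⟨n + 1⟩)
    simp only [Function.iterate_succ_apply']
    exact hstep _ _ fun x hx => hiter Z (hn _ (Finset.mem_image_of_mem _ hx)) (hf x hx)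
  · have hinf : ℵ₀ ≤ max #Z μ := hμ.trans (le_max_right _ _)
    have hn : ∀ n, #↥(step^[n] Z) ≤ max #Z μ := fun n => by
      induction n with
      | zero => exact le_max_left _ _
      | succ n ih =>
        rw [Function.iterate_succ_apply']
        exact (hcard _).trans (max_le ih (le_max_right _ _))
    refine (mk_iUnion_le _).trans (mul_le_of_le hinf ?_ (ciSup_le' fun n => hn _))
    simpa using hinf

namespace SimpleGraph

variable {V : Type u} (G : SimpleGraph V)

/-- If each finite set `K` of vertices is assigned a set `N K` of at most `μ` vertices such that every
set of at least `μ` neighbours of a vertex `v` contains some nonempty `K` with `v ∈ N K`, then every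
set `Y` of vertices has a well-ordering, here given by an injective rank function, in which the
back-degrees inside `Y` are smaller than `μ`. -/
theorem exists_rank_backDegree_lt {μ : Cardinal.{u}} (hμ : ℵ₀ ≤ μ) (N : Finset V → Set V)
    (hN : ∀ K, #(N K) ≤ μ)
    (hK : ∀ v, ∀ X ⊆ G.neighborSet v, μ ≤ #X →
      ∃ K : Finset V, K.Nonempty ∧ ↑K ⊆ X ∧ v ∈ N K) (Y : Set V) :
    ∃ f : V → Ordinal.{u}, Function.Injective f ∧
      ∀ v ∈ Y, #{w ∈ Y | G.Adj v w ∧ f w < f v} < μ := by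
  obtain ⟨cl, hmono, hext, hclosed, hcard⟩ := exists_closure_mk_le hμ N hN
  induction hY : #Y using WellFoundedLT.induction generalizing Y with
  | ind c ih =>
  subst hY
  obtain ⟨r, hr, hord⟩ := exists_ord_eq Y
  obtain ⟨s, hs⟩ : ∃ s : V → V → Prop, IsWellOrder V s := ⟨WellOrderingRel, inferInstance⟩
  let τ : V → Ordinal.{u} := Ordinal.typein s
  classical
  let e : Y → Ordinal.{u} := Ordinal.typein r
  have he : ∀ y, e y < (#Y).ord := fun y => hord ▸ Ordinal.typein_lt_type r y
  have hseg : ∀ y : Y, #{v | ∃ h : v ∈ Y, e ⟨v, h⟩ < e y} < #Y := fun y => by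
    refine lt_of_le_of_lt ?_ (card_typein_lt y hord)
    refine (mk_le_mk_of_subset (t := Subtype.val '' {x | r x y}) ?_).trans mk_image_le
    rintro v ⟨h, hlt⟩
    exact ⟨⟨v, h⟩, (Ordinal.typein_lt_typein r).1 hlt, rfl⟩
  rcases le_or_gt #Y μ with hle | hlt
  -- Vertices outside `Y` go after `Y`, for injectivity only.
  · refine ⟨fun v => if h : v ∈ Y then e ⟨v, h⟩ else (#Y).ord + τ v, fun v w hvw => ?_,
      fun v hv => ?_⟩
    · simp only at hvw
      split_ifs at hvw with h1 h2 h2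
      · exact congrArg Subtype.val (Ordinal.typein_injective r hvw)
      · exact ((he _).not_ge (hvw ▸ le_self_add)).elim
      · exact ((he _).not_ge (hvw ▸ le_self_add)).elim
      · exact Ordinal.typein_injective s (add_left_cancel hvw)
    · refine (mk_le_mk_of_subset ?_).trans_lt ((hseg ⟨v, hv⟩).trans_le hle)
      rintro w ⟨hw, -, hlt⟩
      simp only [dif_pos hw, dif_pos hv] at hlt
      exact ⟨hw, hlt⟩
  · have hinf := hμ.trans hlt.le
    let C : Ordinal.{u} → Set V := fun o => cl {v | ∃ h : v ∈ Y, e ⟨v, h⟩ ≤ o}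
    have hC : Monotone C := fun o o' h => hmono fun v ⟨hv, hle⟩ => ⟨hv, hle.trans h⟩
    have hCe : ∀ y : Y, y.1 ∈ C (e y) := fun y => hext _ ⟨y.2, le_rfl⟩
    -- The first stage of the chain containing `v`; the final order is lexicographic, by `ρ` and
    -- then by the inductive order on that stage.
    let ρ : V → Ordinal.{u} := fun v => sInf {o | v ∈ C o}
    have hρ : ∀ y ∈ Y, y ∈ C (ρ y) := fun y hy =>
      show ρ y ∈ {o | y ∈ C o} from csInf_mem ⟨_, hCe ⟨y, hy⟩⟩
    have hρle : ∀ y : Y, ρ y ≤ e y := fun y => csInf_le' (hCe y)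
    have hCcard : ∀ o, o < (#Y).ord → #(C o) < #Y := by
      intro o ho
      refine (hcard _).trans_lt (max_lt ?_ hlt)
      obtain ⟨x, rfl⟩ := Ordinal.typein_surj r (hord ▸ ho)
      refine (mk_le_mk_of_subset (t := insert x.1 {v | ∃ h : v ∈ Y, e ⟨v, h⟩ < e x}) ?_).trans_lt
        (mk_insert_le.trans_lt (add_lt_of_lt hinf (hseg x) (one_lt_aleph0.trans_le hinf)))
      rintro v ⟨hv, hle⟩
      rcases hle.lt_or_eq with h | h
      · exact Or.inr ⟨hv, h⟩
      · exact Or.inl (congrArg Subtype.val (Ordinal.typein_injective r h))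
    have hpiece : ∀ o, ∃ f : V → Ordinal.{u}, Function.Injective f ∧ (o < (#Y).ord →
        ∀ v ∈ Y ∩ C o, #{w ∈ Y ∩ C o | G.Adj v w ∧ f w < f v} < μ) := fun o => by
      by_cases ho : o < (#Y).ord
      · obtain ⟨f, hf, hf'⟩ := ih _ ((mk_le_mk_of_subset Set.inter_subset_right).trans_lt
          (hCcard o ho)) (Y ∩ C o) rfl
        exact ⟨f, hf, fun _ => hf'⟩
      · exact ⟨τ, Ordinal.typein_injective s, fun h => (ho h).elim⟩
    choose f hf hback using hpiece
    let g : V → Ordinal.{u} ×ₗ Ordinal.{u} := fun v => toLex (ρ v, f (ρ v) v)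
    have hg : Function.Injective g := fun v w h => by
      have h1 : ρ v = ρ w := congrArg (fun p => (ofLex p).1) h
      have h2 : f (ρ v) v = f (ρ w) w := congrArg (fun p => (ofLex p).2) h
      exact hf (ρ w) (h1 ▸ h2)
    have hwo : IsWellOrder V (InvImage (· < ·) g) :=
      (⟨⟨g, hg⟩, Iff.rfl⟩ : InvImage (· < ·) g ↪r (· < ·)).isWellOrder
    refine ⟨Ordinal.typein (InvImage (· < ·) g), Ordinal.typein_injective _, fun v hv => ?_⟩
    have hlow : #↥(G.neighborSet v ∩ {w ∈ Y | ρ w < ρ v}) < μ := by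
      by_contra! hge
      obtain ⟨K, hKne, hKX, hvK⟩ := hK v _ Set.inter_subset_left hge
      -- The finite set `K` lies in the stage of its `ρ`-largest element, which is closed and so
      -- already contains `v`, too early.
      obtain ⟨x, hx, hmax⟩ := K.exists_max_image ρ hKne
      have hlt : ρ x < ρ v := (hKX hx).2.2
      refine hlt.not_ge (csInf_le' (hclosed _ K (fun w hw => ?_) hvK))
      exact hC (hmax w hw) (hρ w (hKX hw).2.1)
    have hsame := hback (ρ v) ((hρle ⟨v, hv⟩).trans_lt (he _)) v ⟨hv, hρ v hv⟩
    refine (mk_le_mk_of_subset ?_).trans_lt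
      ((mk_union_le _ _).trans_lt (add_lt_of_lt hμ hlow hsame))
    rintro w ⟨hw, hadj, hwv⟩
    rw [Ordinal.typein_lt_typein] at hwv
    rcases Prod.Lex.toLex_lt_toLex.1 hwv with h | ⟨h1, h2⟩
    · exact Or.inl ⟨hadj, hw, h⟩
    · simp only at h1 h2
      exact Or.inr ⟨⟨hw, h1 ▸ hρ w hw⟩, hadj, by rwa [h1] at h2⟩

theorem isIndContained_completeBipartiteGraph {k : ℕ} {A : Finset V} {I : Set V}
    (hA : A.card = k) (hinf : I.Infinite) (hAindep : G.IsIndepSet (A : Set V))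
    (hI : G.IsIndepSet I) (hadj : ∀ v ∈ A, ∀ w ∈ I, G.Adj v w) :
    (completeBipartiteGraph (Fin k) ℕ).IsIndContained G := by
  let a : Fin k ≃ A := (A.equivFinOfCardEq hA).symm
  let b : ℕ ↪ I := hinf.natEmbedding
  have hnot : ∀ {S : Set V}, G.IsIndepSet S → ∀ x ∈ S, ∀ y ∈ S, ¬ G.Adj x y :=
    fun hS x hx y hy h => hS hx hy h.ne h
  refine ⟨⟨⟨Sum.elim (fun i => (a i).1) fun n => (b n).1, ?_⟩, ?_⟩⟩
  · refine (Subtype.val_injective.comp a.injective).sumElim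
      (Subtype.val_injective.comp b.injective) fun i n => (hadj _ (a i).2 _ (b n).2).ne
  · rintro (i | i) (j | j)
    · simpa using hnot hAindep _ (a i).2 _ (a j).2
    · simpa using hadj _ (a i).2 _ (b j).2
    · simpa using (hadj _ (a j).2 _ (b i).2).symm
    · simpa using hnot hI _ (b i).2 _ (b j).2

end SimpleGraph

theorem mainTheorem4 {V : Type*} (G : SimpleGraph V) (μ : Cardinal) (hμ : ℵ₀ ≤ μ)
    (hcol : μ < G.colouringNumber) :
    (∃ S : Set V, #↥S = μ ∧ G.IsClique S) ∨
      ∀ k : ℕ, 0 < k → (completeBipartiteGraph (Fin k) ℕ).IsIndContained G := by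
  by_contra! hcon
  obtain ⟨hclique, k, hk, hbip⟩ := hcon
  have hindep : ∀ X : Set V, μ ≤ #X → ∃ I ⊆ X, I.Infinite ∧ G.IsIndepSet I := by
    intro X hX
    by_contra! h
    obtain ⟨Y, hYX, rfl⟩ := le_mk_iff_exists_subset.1 hX
    obtain ⟨S, -, hS, hS'⟩ := G.exists_isClique_mk_eq hμ
      fun I hI hI' => Set.not_infinite.1 fun hinf => h I (hI.trans hYX) hinf hI'
    exact hclique S hS hS'
  let N : Finset V → Set V := fun K =>
    {v | G.IsIndepSet (K : Set V) ∧ K.card = k ∧ ∀ w ∈ K, G.Adj v w}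
  have hN : ∀ K, #(N K) ≤ μ := by
    intro K
    by_contra! hlt
    obtain ⟨I, hIN, hinf, hI⟩ := hindep (N K) hlt.le
    obtain ⟨x, hx⟩ := hinf.nonempty
    obtain ⟨hKindep, hKcard, -⟩ := hIN hx
    refine hbip ?_
    exact SimpleGraph.isIndContained_completeBipartiteGraph G hKcard hinf
      hKindep hI fun v hv w hw => (hIN hw).2.2 v hv |>.symm
  obtain ⟨f, hf, hback⟩ := G.exists_rank_backDegree_lt hμ N hN (fun v X hXv hX => by
    obtain ⟨I, hIX, hinf, hI⟩ := hindep X hX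
    obtain ⟨K, hKI, hKcard⟩ := hinf.exists_subset_card_eq k
    exact ⟨K, Finset.card_pos.1 (hKcard ▸ hk), hKI.trans hIX, hI.mono hKI, hKcard,
      fun w hw => hXv (hIX (hKI hw))⟩) Set.univ
  refine hcol.not_ge (csInf_le' ⟨InvImage (· < ·) f,
    (⟨⟨f, hf⟩, Iff.rfl⟩ : InvImage (· < ·) f ↪r (· < ·)).isWellOrder, fun v => ?_⟩)
  refine (mk_le_mk_of_subset ?_).trans_lt (hback v trivial)
  exact fun w hw => ⟨trivial, hw.1, hw.2⟩
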